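/- All algebras are graded-commutative, graded by $\mathbb N$, over $\mathbb Q$; DGAs have differentials of degree $+1$. Let $G$ be a finite group and $\mathcal O_G$ its orbit category (objects $G/H$, $H\le G$; morphisms the $G$-maps). A dual coefficient system is a covariant functor from $\mathcal O_G$ to rational vector spaces. A diagram of graded algebras (or DGAs) is a covariant functor from $\mathcal O_G$ to graded algebras (or DGAs); it is called a system if each of its homogeneous parts is an injective object in the category of dual coefficient systems. A morphism of diagrams of DGAs is a quasi-isomorphism if it induces an isomorphism in cohomology at every $G/H$. Let $\mathcal U$ be a diagram of DGAs, $\underline V$ a dual coefficient system placed in degree $n$, and $\alpha:\underline V\to \underline Z^{n+1}(\mathcal U)$ a map to the cocycles. Let $\underline V\to\underline V_0\xrightarrow{w_0}\underline V_1\xrightarrow{w_1}\cdots$ be the minimal injective resolution ($\underline V_0$ is an injective envelope of $\underline V$, and every further term is an injective envelope of the cokernel of the preceding map), and let $\alpha_k:\underline V_k\to\mathcal U^{n+k+1}$ be maps such that $\alpha_0|_{\underline V}=\alpha$ and $\alpha_{k+1}w_k=d\alpha_k$. The corresponding elementary extension of $\mathcal U$ of degree $n$ is $\mathcal U\otimes\bigotimes_k\mathbb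 Q(\underline V_k)$, where $\mathbb Q(\underline V_k)$ is the free graded commutative algebra on $\underline V_k$ in degree $n+k$, with the differential extending that of $\mathcal U$ and equal to $(-1)^k\alpha_k+w_k$ on $\underline V_k$. A minimal system is a system of DGAs $\mathscr M$ with an increasing filtration $\mathscr M=\bigcup_n\mathscr M_n$ by subdiagrams such that $\mathscr M_0=\mathscr M_1=\mathbb Q$ and, for $n\ge2$, $\mathscr M_n$ is an elementary extension of $\mathscr M_{n-1}$ by some dual coefficient system $\underline V^{(n)}$ in degree $n$. The $\underline V^{(n)}$ are called the associated systems of vector spaces. A minimal algebra is a DGA $N=\bigcup_n N_n$, an increasing union of sub-DGAs with $N_0=N_1=\mathbb Q$ such that, for $n\ge 2$, $N_n$ is a Hirsch extension of $N_{n-1}$ in degree $n$: $N_n=N_{n-1}\otimes\mathbb Q(V)$ with $V$ a vector space in degree $n$, and $d$ maps $V$ to the cocycles of degree $n+1$ of $N_{n-1}$. **Proposition.** Let $\mathcal A$ be a system of graded algebras over $G$ (that is, $\mathcal A$ is injective), regarded as a diagram of DGAs with zero differential. Let $\mathscr M$ be a minimal system with a quasi-isomorphism $\mathscr M\to\mathcal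 A$, such that the associated system of vector spaces $\underline V^{(n)}$ is injective for each $n\ge 2$. Let $H\le G$, and let $N_H$ be a minimal algebra with a quasi-isomorphism $\rho_H:N_H\to\mathcal A(G/H)$ (where $\mathcal A(G/H)$ has zero differential). Then $\mathscr M(G/H)\cong N_H$ as DGAs. -/

import Mathlib

open CategoryTheory

universe v u

namespace EquivariantDGA

/-! ### Graded commutative algebras and commutative DGAs over the rationals -/

/-- A graded commutative algebra over `ℚ`, graded by the natural numbers
(`deg n` is the subspace of elements of degree `n`). -/
structure GradedAlg : Type (u + 1) where
  carrier : Type u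
  [ring : Ring carrier]
  [algebra : Algebra ℚ carrier]
  deg : ℕ → Submodule ℚ carrier
  [graded : GradedAlgebra deg]
  graded_comm : ∀ (i j : ℕ) (a b : carrier), a ∈ deg i → b ∈ deg j →
    a * b = ((-1 : ℚ) ^ (i * j)) • (b * a)

attribute [instance] GradedAlg.ring GradedAlg.algebra GradedAlg.graded

/-- Morphisms of graded algebras: algebra maps preserving degrees. -/
@[ext]
structure GradedAlg.Hom (A B : GradedAlg.{u}) : Type u where
  toAlgHom : A.carrier →ₐ[ℚ] B.carrier
  map_deg : ∀ (n : ℕ) (a : A.carrier), a ∈ A.deg n → toAlgHom a ∈ B.deg n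

instance : Category GradedAlg.{u} where
  Hom := GradedAlg.Hom
  id A := ⟨AlgHom.id ℚ A.carrier, fun _ _ h => h⟩
  comp f g := ⟨g.toAlgHom.comp f.toAlgHom, fun n a h => g.map_deg n _ (f.map_deg n a h)⟩

/-- A commutative differential graded algebra over `ℚ`, with differential of degree `+1`. -/
structure CDGA : Type (u + 1) extends GradedAlg.{u} where
  d : carrier →ₗ[ℚ] carrier
  d_mem : ∀ (n : ℕ) (a : carrier), a ∈ deg n → d a ∈ deg (n + 1)
  d_d : ∀ a : carrier, d (d a) = 0
  leibniz : ∀ (n : ℕ) (a b : carrier), a ∈ deg n →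
    d (a * b) = d a * b + ((-1 : ℚ) ^ n) • (a * d b)

/-- Morphisms of DGAs: graded algebra maps commuting with the differentials. -/
@[ext]
structure CDGA.Hom (A B : CDGA.{u}) : Type u extends
    GradedAlg.Hom A.toGradedAlg B.toGradedAlg where
  map_d : ∀ a : A.carrier, toAlgHom (A.d a) = B.d (toAlgHom a)

instance : Category CDGA.{u} where
  Hom := CDGA.Hom
  id A := ⟨𝟙 A.toGradedAlg, fun _ => rfl⟩
  comp {A B C} f g :=
    { toAlgHom := g.toAlgHom.comp f.toAlgHom
      map_deg := fun n a h => g.map_deg n _ (f.map_deg n a h)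
      map_d := fun a => by
        change g.toAlgHom (f.toAlgHom (A.d a)) = C.d (g.toAlgHom (f.toAlgHom a))
        rw [f.map_d, g.map_d] }

/-- The action of a DGA morphism on elements. -/
def CDGA.toFun {A B : CDGA.{u}} (f : A ⟶ B) : A.carrier → B.carrier :=
  (CDGA.Hom.toHom f).toAlgHom

/-- Forgetting the differential. -/
def forgetD : CDGA.{u} ⥤ GradedAlg.{u} where
  obj A := A.toGradedAlg
  map f := CDGA.Hom.toHom f

/-- A graded algebra regarded as a DGA with zero differential. -/
def zeroD : GradedAlg.{u} ⥤ CDGA.{u} where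
  obj A :=
    { A with
      d := 0
      d_mem := fun n _ _ => (A.deg (n + 1)).zero_mem
      d_d := fun _ => rfl
      leibniz := fun _ _ _ _ => by simp }
  map f := { toHom := f, map_d := fun a => map_zero (GradedAlg.Hom.toAlgHom f) }

/-- The functor taking a graded algebra to the vector space of its degree `n` elements. -/
def degFunctor (n : ℕ) : GradedAlg.{u} ⥤ ModuleCat.{u} ℚ where
  obj A := ModuleCat.of ℚ (A.deg n)
  map {A B} f := ModuleCat.ofHom
    (((GradedAlg.Hom.toAlgHom f).toLinearMap).restrict (p := A.deg n) (q := B.deg n)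
      (GradedAlg.Hom.map_deg f n))

/-! ### Cohomology and quasi-isomorphisms -/

/-- Cocycles of degree `n`. -/
def CDGA.cocycles (A : CDGA.{u}) (n : ℕ) : Submodule ℚ A.carrier :=
  A.deg n ⊓ LinearMap.ker A.d

/-- Coboundaries of degree `n`: elements of degree `n` in the image of `d`. -/
def CDGA.coboundaries (A : CDGA.{u}) (n : ℕ) : Submodule ℚ A.carrier :=
  A.deg n ⊓ LinearMap.range A.d

/-- The cohomology `Hⁿ(A)`: cocycles of degree `n` modulo coboundaries. -/
abbrev CDGA.cohomology (A : CDGA.{u}) (n : ℕ) : Type u :=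
  A.cocycles n ⧸ (A.coboundaries n).comap (A.cocycles n).subtype

/-- The map induced by a DGA morphism on cocycles. -/
def CDGA.cocyclesMap {A B : CDGA.{u}} (f : A ⟶ B) (n : ℕ) :
    A.cocycles n →ₗ[ℚ] B.cocycles n :=
  ((CDGA.Hom.toHom f).toAlgHom.toLinearMap).restrict fun a ha =>
    ⟨(CDGA.Hom.toHom f).map_deg n a ha.1, by
      have h : A.d a = 0 := ha.2
      have h2 := CDGA.Hom.map_d f a
      rw [h, map_zero] at h2
      exact h2.symm⟩

/-- The map induced by a DGA morphism on cohomology. -/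
def CDGA.cohomologyMap {A B : CDGA.{u}} (f : A ⟶ B) (n : ℕ) :
    A.cohomology n →ₗ[ℚ] B.cohomology n :=
  Submodule.mapQ _ _ (CDGA.cocyclesMap f n) fun a ha =>
    ⟨(CDGA.Hom.toHom f).map_deg n a.1 ha.1, by
      obtain ⟨b, hb⟩ := ha.2
      refine ⟨(CDGA.Hom.toHom f).toAlgHom b, ?_⟩
      have h2 := CDGA.Hom.map_d f b
      rw [hb] at h2
      exact h2.symm⟩

/-- A quasi-isomorphism of DGAs. -/
def CDGA.IsQuasiIso {A B : CDGA.{u}} (f : A ⟶ B) : Prop :=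
  ∀ n : ℕ, Function.Bijective (CDGA.cohomologyMap f n)

/-! ### Free extensions and minimal algebras -/

/-- `B` is the free graded commutative extension `U ⊗ ℚ(⊕ₖ Wₖ)` of the graded algebra `U`, where
the vector space `W k` of free generators is placed in degree `e k`, through the structure map
`i : U ⟶ B` and the inclusions `j k` of the generators; expressed by the universal property
among graded commutative algebras. -/
def IsFreeExtension {κ : Type} (e : κ → ℕ) {U B : GradedAlg.{u}} (i : U ⟶ B)
    (W : κ → ModuleCat.{u} ℚ) (j : ∀ k, W k ⟶ (degFunctor (e k)).obj B) : Prop :=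
  ∀ (C : GradedAlg.{u}) (f : U ⟶ C) (g : ∀ k, W k ⟶ (degFunctor (e k)).obj C),
    ∃! h : B ⟶ C, i ≫ h = f ∧ ∀ k, j k ≫ (degFunctor (e k)).map h = g k

/-- `i : U ⟶ B` exhibits the DGA `B` as a Hirsch extension of `U` by the vector space `V` placed
in degree `n`: `B = U ⊗ ℚ(V)` as graded algebra, and the differential extends that of `U` and is
given on `V` by a linear map `δ : V → Zⁿ⁺¹(U)`. -/
structure HirschExtension (n : ℕ) (V : ModuleCat.{u} ℚ) {U B : CDGA.{u}} (i : U ⟶ B) where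
  δ : V ⟶ (degFunctor (n + 1)).obj U.toGradedAlg
  δ_cocycle : ∀ x : V, U.d (δ x).1 = 0
  gen : V ⟶ (degFunctor n).obj B.toGradedAlg
  d_gen : ∀ x : V, B.d (gen x).1 = CDGA.toFun i (δ x).1
  free : IsFreeExtension (fun _ : Unit => n) (forgetD.map i) (fun _ => V) (fun _ => gen)

/-- The structure of a minimal algebra on `N`: it is the increasing union of sub-DGAs
`N₀ ⊆ N₁ ⊆ N₂ ⊆ ⋯` with `N₀ = N₁ = ℚ`, and for `k ≥ 2` the inclusion of `N_{k-1}` in `N_k` is a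
Hirsch extension by a vector space of degree `k`. -/
structure MinimalAlgebraStructure (N : CDGA.{u}) where
  stage : ℕ → CDGA.{u}
  incl : ∀ n, stage n ⟶ stage (n + 1)
  toN : ∀ n, stage n ⟶ N
  incl_toN : ∀ n, incl n ≫ toN (n + 1) = toN n
  toN_injective : ∀ n, Function.Injective (CDGA.toFun (toN n))
  union : ∀ x : N.carrier, ∃ n y, CDGA.toFun (toN n) y = x
  stage_zero : Function.Bijective (algebraMap ℚ (stage 0).carrier)
  stage_one : Function.Bijective (algebraMap ℚ (stage 1).carrier)
  V : ℕ → ModuleCat.{u} ℚ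
  ext : ∀ n, HirschExtension (n + 2) (V (n + 2)) (incl (n + 1))

/-- A (non-equivariant) minimal algebra. -/
def CDGA.IsMinimal (N : CDGA.{u}) : Prop := Nonempty (MinimalAlgebraStructure N)

/-! ### Diagrams over the orbit category -/

/-- The orbit category of `G`: the objects are the `G`-sets `G ⧸ H` for subgroups `H` of `G` and
the morphisms are the `G`-maps between them. -/
structure OrbitCat (G : Type v) [Group G] : Type v where
  subgroup : Subgroup G

instance (G : Type v) [Group G] : Category (OrbitCat G) where
  Hom X Y := (G ⧸ X.subgroup) →[G] (G ⧸ Y.subgroup)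
  id X := MulActionHom.id G
  comp f g := g.comp f

/-- Dual rational coefficient systems: covariant functors from the orbit category to rational
vector spaces. -/
abbrev DualCoeff (G : Type v) [Group G] := OrbitCat G ⥤ ModuleCat.{u} ℚ

/-- Orbit diagrams of graded algebras. -/
abbrev DiagramGA (G : Type v) [Group G] := OrbitCat G ⥤ GradedAlg.{u}

/-- Orbit diagrams of DGAs. -/
abbrev DiagramDGA (G : Type v) [Group G] := OrbitCat G ⥤ CDGA.{u}

/-- The degree `n` part of a diagram of graded algebras. -/
abbrev DiagramGA.degPart {G : Type v} [Group G] (A : DiagramGA.{v, u} G) (n : ℕ) :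
    DualCoeff.{v, u} G := A ⋙ degFunctor n

/-- The degree `n` part of a diagram of DGAs, with the differential forgotten. -/
abbrev DiagramDGA.degPart {G : Type v} [Group G] (A : DiagramDGA.{v, u} G) (n : ℕ) :
    DualCoeff.{v, u} G := A ⋙ forgetD ⋙ degFunctor n

/-- The element of `A(G/H)` underlying an element of its degree `n` part. -/
abbrev DiagramDGA.elt {G : Type v} [Group G] (A : DiagramDGA.{v, u} G) {n : ℕ} {X : OrbitCat G}
    (x : (A.degPart n).obj X) : (A.obj X).carrier :=
  Subtype.val (p := fun a => a ∈ (A.obj X).deg n) x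

/-- A diagram of graded algebras is injective (is a system of graded algebras) if in each degree
it is an injective object among dual rational coefficient systems. -/
def DiagramGA.IsSystem {G : Type v} [Group G] (A : DiagramGA.{v, u} G) : Prop :=
  ∀ n, Injective (A.degPart n)

/-- A diagram of DGAs is injective (is a system of DGAs) if in each degree the underlying dual
rational coefficient system is injective. -/
def DiagramDGA.IsSystem {G : Type v} [Group G] (A : DiagramDGA.{v, u} G) : Prop :=
  ∀ n, Injective (A.degPart n)

/-- A quasi-isomorphism of diagrams: a morphism inducing isomorphisms in cohomology at every
orbit `G/H`. -/
def DiagramDGA.IsQuasiIso {G : Type v} [Group G] {A B : DiagramDGA.{v, u} G} (f : A ⟶ B) : Prop :=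
  ∀ X, CDGA.IsQuasiIso (f.app X)

/-! ### Minimal injective resolutions -/

/-- `f : X ⟶ Y` is an injective envelope: `Y` is injective and `f` is an essential
monomorphism. -/
structure IsInjectiveEnvelope {C : Type*} [Category C] {X Y : C} (f : X ⟶ Y) : Prop where
  injective : Injective Y
  mono : Mono f
  essential : ∀ ⦃Z : C⦄ (g : Y ⟶ Z), Mono (f ≫ g) → Mono g

/-- A minimal injective resolution `V → V₀ → V₁ → V₂ → ⋯` of a dual rational coefficient system:
`V₀` is an injective envelope of `V`, and each further term is an injective envelope of the
cokernel of the preceding map. -/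
structure MinimalInjectiveResolution {G : Type v} [Group G] (V : DualCoeff.{v, u} G) where
  I : ℕ → DualCoeff.{v, u} G
  ι : V ⟶ I 0
  w : ∀ k, I k ⟶ I (k + 1)
  ι_w : ι ≫ w 0 = 0
  w_w : ∀ k, w k ≫ w (k + 1) = 0
  env_zero : IsInjectiveEnvelope ι
  env_one : IsInjectiveEnvelope (Limits.cokernel.desc ι (w 0) ι_w)
  env_succ : ∀ k, IsInjectiveEnvelope (Limits.cokernel.desc (w k) (w (k + 1)) (w_w k))

/-! ### Elementary extensions and minimal systems -/

/-- `i : U ⟶ B` exhibits the diagram of DGAs `B` as an elementary extension of `U` with respect to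
a dual coefficient system `V` in degree `n` and a map `α : V → Zⁿ⁺¹(U)`. One takes the minimal
injective resolution `V → V₀ → V₁ → ⋯` and maps `αₖ : Vₖ → Uⁿ⁺ᵏ⁺¹` compatible with `α` and the
differential; then `B = U ⊗ ℚ(V₀) ⊗ ℚ(V₁) ⊗ ⋯` with `Vₖ` in degree `n + k` and
`d = (-1)ᵏ αₖ + wₖ` on `Vₖ`. -/
structure ElementaryExtension {G : Type v} [Group G] (n : ℕ) (V : DualCoeff.{v, u} G)
    {U B : DiagramDGA.{v, u} G} (i : U ⟶ B) where
  α : V ⟶ U.degPart (n + 1)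
  α_cocycle : ∀ (X : OrbitCat G) (x : V.obj X), (U.obj X).d (U.elt (α.app X x)) = 0
  res : MinimalInjectiveResolution V
  αk : ∀ k, res.I k ⟶ U.degPart (n + k + 1)
  ι_αk : res.ι ≫ αk 0 = α
  w_αk : ∀ (k : ℕ) (X : OrbitCat G) (x : (res.I k).obj X),
    U.elt ((αk (k + 1)).app X ((res.w k).app X x)) = (U.obj X).d (U.elt ((αk k).app X x))
  gen : ∀ k, res.I k ⟶ B.degPart (n + k)
  d_gen : ∀ (k : ℕ) (X : OrbitCat G) (x : (res.I k).obj X),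
    (B.obj X).d (B.elt ((gen k).app X x)) =
      ((-1 : ℚ) ^ k) • CDGA.toFun (i.app X) (U.elt ((αk k).app X x)) +
        B.elt ((gen (k + 1)).app X ((res.w k).app X x))
  free : ∀ X : OrbitCat G, IsFreeExtension (fun k : ℕ => n + k) (forgetD.map (i.app X))
    (fun k => (res.I k).obj X) (fun k => (gen k).app X)

/-- The structure of a minimal system on a diagram of DGAs `M`: it is a system of DGAs which is the
increasing union of subdiagrams `M₀ ⊆ M₁ ⊆ M₂ ⊆ ⋯` with `M₀ = M₁` the constant diagram `ℚ`, and
for `k ≥ 2` the inclusion of `M_{k-1}` in `M_k` is an elementary extension with respect to a dual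
coefficient system `V k` in degree `k` (the `k`-th associated system of vector spaces). -/
structure MinimalSystemStructure {G : Type v} [Group G] (M : DiagramDGA.{v, u} G) where
  isSystem : M.IsSystem
  stage : ℕ → DiagramDGA.{v, u} G
  incl : ∀ n, stage n ⟶ stage (n + 1)
  toM : ∀ n, stage n ⟶ M
  incl_toM : ∀ n, incl n ≫ toM (n + 1) = toM n
  toM_injective : ∀ n X, Function.Injective (CDGA.toFun ((toM n).app X))
  union : ∀ (X : OrbitCat G) (x : (M.obj X).carrier), ∃ n y, CDGA.toFun ((toM n).app X) y = x
  stage_zero : ∀ X, Function.Bijective (algebraMap ℚ ((stage 0).obj X).carrier)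
  stage_one : ∀ X, Function.Bijective (algebraMap ℚ ((stage 1).obj X).carrier)
  V : ℕ → DualCoeff.{v, u} G
  ext : ∀ n, ElementaryExtension (n + 2) (V (n + 2)) (incl (n + 1))

end EquivariantDGA

/-! An injective object is its own injective envelope, so when every associated system is injective
its minimal injective resolution is concentrated in the term `I 0`. Evaluated at an orbit, each
elementary extension then becomes a Hirsch extension (`ElementaryExtension.hirsch`), so M(G/H) is an
ordinary minimal algebra. It is quasi-isomorphic to A(G/H), and the theorem reduces to uniqueness of
the minimal model of an algebra C with zero differential.

For such C, a map N → C from a minimal algebra lifts strictly, not merely up to homotopy, along a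
quasi-isomorphism N' → C: every element of C is a cocycle and no nonzero element is a coboundary, so
generators can be lifted one degree at a time (`HirschExtension.exists_lift`). The lift N → N' is an
isomorphism in cohomology by two out of three.

Finally, a cohomology isomorphism between minimal algebras is bijective, by induction on the stages
(`StageEquiv.succ`). The induction rests on minimality: elements of degree n lie in stage n, and
their differentials already lie in stage n - 1. Free extensions enter only through generation
(`IsFreeExtension.adjoin_eq_top`) and the existence of maps out of them. -/

namespace EquivariantDGA

/-! ### Homogeneous components -/

/-- The projection of a graded algebra onto its degree `n` part. -/
noncomputable def GradedAlg.proj (A : GradedAlg.{u}) (n : ℕ) : A.carrier →ₗ[ℚ] A.carrier :=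
  GradedAlgebra.proj A.deg n

namespace GradedAlg

variable {A B : GradedAlg.{u}}

theorem proj_mem (n : ℕ) (a : A.carrier) : A.proj n a ∈ A.deg n :=
  (DirectSum.decompose A.deg a n).2

theorem proj_of_mem {n : ℕ} {a : A.carrier} (h : a ∈ A.deg n) : A.proj n a = a :=
  DirectSum.decompose_of_mem_same A.deg h

theorem proj_of_mem_ne {m n : ℕ} {a : A.carrier} (h : a ∈ A.deg m) (hmn : m ≠ n) :
    A.proj n a = 0 :=
  DirectSum.decompose_of_mem_ne A.deg h hmn

theorem eq_zero_of_mem_deg {m n : ℕ} {a : A.carrier} (hm : a ∈ A.deg m) (hn : a ∈ A.deg n)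
    (hmn : m ≠ n) : a = 0 := by
  rw [← proj_of_mem hn, proj_of_mem_ne hm hmn]

theorem one_mem_deg : (1 : A.carrier) ∈ A.deg 0 := SetLike.GradedOne.one_mem

theorem algebraMap_mem_deg (q : ℚ) : algebraMap ℚ A.carrier q ∈ A.deg 0 := by
  rw [Algebra.algebraMap_eq_smul_one]
  exact (A.deg 0).smul_mem q one_mem_deg

theorem mul_mem_deg {m n : ℕ} {a b : A.carrier} (ha : a ∈ A.deg m) (hb : b ∈ A.deg n) :
    a * b ∈ A.deg (m + n) :=
  SetLike.GradedMul.mul_mem ha hb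

/-- Induction on a sum of homogeneous elements. -/
theorem homogeneous_induction {p : A.carrier → Prop} (a : A.carrier)
    (hom : ∀ n, ∀ x ∈ A.deg n, p x) (add : ∀ x y, p x → p y → p (x + y)) : p a :=
  DirectSum.Decomposition.inductionOn A.deg (hom 0 0 (A.deg 0).zero_mem)
    (fun x => hom _ x.1 x.2) (fun x y => add x y) a

/-- A linear map which shifts degrees commutes with the projections. -/
theorem proj_linearMap (L : A.carrier →ₗ[ℚ] B.carrier) (e : ℕ → ℕ) (he : Function.Injective e)
    (hL : ∀ n, ∀ x ∈ A.deg n, L x ∈ B.deg (e n)) (n : ℕ) (a : A.carrier) :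
    B.proj (e n) (L a) = L (A.proj n a) := by
  induction a using homogeneous_induction with
  | hom m x hx =>
    by_cases hmn : m = n
    · subst hmn
      rw [proj_of_mem hx, proj_of_mem (hL m x hx)]
    · rw [proj_of_mem_ne hx hmn, proj_of_mem_ne (hL m x hx) (he.ne hmn), map_zero]
  | add x y hx hy => simp only [map_add, hx, hy]

/-- The algebra map underlying a morphism of graded algebras. -/
abbrev alg (f : A ⟶ B) : A.carrier →ₐ[ℚ] B.carrier := GradedAlg.Hom.toAlgHom f

theorem alg_mem (f : A ⟶ B) {n : ℕ} {a : A.carrier} (h : a ∈ A.deg n) : alg f a ∈ B.deg n :=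
  GradedAlg.Hom.map_deg f n a h

theorem proj_alg (f : A ⟶ B) (n : ℕ) (a : A.carrier) :
    B.proj n (alg f a) = alg f (A.proj n a) :=
  proj_linearMap (alg f).toLinearMap id Function.injective_id
    (fun _ _ h => alg_mem f h) n a

/-- An element mapped by an injective morphism to degree `n` has degree `n`. -/
theorem mem_deg_of_alg_mem (f : A ⟶ B) (hf : Function.Injective (alg f)) {n : ℕ} {a : A.carrier}
    (h : alg f a ∈ B.deg n) : a ∈ A.deg n := by
  have h1 : A.proj n a = a := hf (by rw [← proj_alg, proj_of_mem h])
  rw [← h1]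
  exact proj_mem n a

end GradedAlg

/-! ### The graded subalgebra generated by homogeneous elements -/

namespace GradedAlg

variable {A : GradedAlg.{u}}

theorem exists_mem_deg_of_mem_closure {s : Set A.carrier} (hs : ∀ x ∈ s, ∃ n, x ∈ A.deg n)
    {x : A.carrier} (hx : x ∈ Submonoid.closure s) : ∃ n, x ∈ A.deg n := by
  induction hx using Submonoid.closure_induction with
  | mem x h => exact hs x h
  | one => exact ⟨0, one_mem_deg⟩
  | mul x y _ _ hx hy =>
    obtain ⟨m, hm⟩ := hx
    obtain ⟨n, hn⟩ := hy
    exact ⟨m + n, mul_mem_deg hm hn⟩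

theorem proj_mem_adjoin {s : Set A.carrier} (hs : ∀ x ∈ s, ∃ n, x ∈ A.deg n) (n : ℕ)
    {x : A.carrier} (hx : x ∈ Algebra.adjoin ℚ s) : A.proj n x ∈ Algebra.adjoin ℚ s := by
  rw [← Subalgebra.mem_toSubmodule, Algebra.adjoin_eq_span] at hx ⊢
  induction hx using Submodule.span_induction with
  | mem x h =>
    obtain ⟨m, hm⟩ := exists_mem_deg_of_mem_closure hs h
    by_cases hmn : m = n
    · subst hmn
      rw [proj_of_mem hm]
      exact Submodule.subset_span h
    · rw [proj_of_mem_ne hm hmn]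
      exact Submodule.zero_mem _
  | zero => simp
  | add x y _ _ hx hy =>
    rw [map_add]
    exact Submodule.add_mem _ hx hy
  | smul c x _ hx =>
    rw [map_smul]
    exact Submodule.smul_mem _ c hx

/-- Independence is inherited from the ambient grading, and an element of `S` is the finite sum of
its projections, which stay in `S`. -/
theorem isInternal_comap_subalgebra (S : Subalgebra ℚ A.carrier)
    (hS : ∀ n, ∀ x ∈ S, A.proj n x ∈ S) :
    DirectSum.IsInternal fun n => (A.deg n).comap S.val.toLinearMap := by
  classical
  refine DirectSum.isInternal_submodule_of_iSupIndep_of_iSup_eq_top (fun i => ?_) ?_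
  · rw [Submodule.disjoint_def]
    intro x hx hx'
    have hind := (DirectSum.Decomposition.isInternal A.deg).submodule_iSupIndep i
    rw [Submodule.disjoint_def] at hind
    apply Subtype.ext
    refine hind x.1 hx ?_
    have hle : (⨆ j, ⨆ (_ : j ≠ i), (A.deg j).comap S.val.toLinearMap) ≤
        (⨆ j, ⨆ (_ : j ≠ i), A.deg j).comap S.val.toLinearMap :=
      iSup₂_le fun j hj => Submodule.comap_mono (le_iSup₂_of_le j hj le_rfl)
    exact hle hx'
  · rw [eq_top_iff]
    rintro x -
    have hx : x = ∑ i ∈ (DirectSum.decompose A.deg x.1).support,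
        (⟨A.proj i x.1, hS i x.1 x.2⟩ : S) := by
      apply Subtype.ext
      rw [AddSubmonoidClass.coe_finsetSum]
      exact (DirectSum.sum_support_decompose A.deg x.1).symm
    rw [hx]
    exact Submodule.sum_mem _ fun i _ =>
      Submodule.mem_iSup_of_mem i (show A.proj i x.1 ∈ A.deg i from proj_mem i x.1)

/-- A subalgebra closed under taking homogeneous components, as a graded algebra. -/
noncomputable def ofSubalgebra (S : Subalgebra ℚ A.carrier)
    (hS : ∀ n, ∀ x ∈ S, A.proj n x ∈ S) : GradedAlg.{u} :=
  letI : DirectSum.Decomposition fun n => (A.deg n).comap S.val.toLinearMap :=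
    (isInternal_comap_subalgebra S hS).chooseDecomposition
  { carrier := S
    deg := fun n => (A.deg n).comap S.val.toLinearMap
    graded :=
      { one_mem := one_mem_deg (A := A)
        mul_mem := fun _ _ _ _ ha hb => mul_mem_deg (A := A) ha hb }
    graded_comm := fun i j a b ha hb => Subtype.ext (A.graded_comm i j a.1 b.1 ha hb) }

/-- The inclusion of a subalgebra closed under taking homogeneous components. -/
noncomputable def ofSubalgebraIncl (S : Subalgebra ℚ A.carrier)
    (hS : ∀ n, ∀ x ∈ S, A.proj n x ∈ S) : ofSubalgebra S hS ⟶ A :=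
  GradedAlg.Hom.mk (A := ofSubalgebra S hS) S.val fun _ _ h => h

/-- The corestriction of a morphism to a subalgebra containing its values. -/
noncomputable def ofSubalgebraLift {B : GradedAlg.{u}} (S : Subalgebra ℚ A.carrier)
    (hS : ∀ n, ∀ x ∈ S, A.proj n x ∈ S) (f : B ⟶ A) (hf : ∀ x, alg f x ∈ S) :
    B ⟶ ofSubalgebra S hS :=
  GradedAlg.Hom.mk (B := ofSubalgebra S hS) ((alg f).codRestrict S hf)
    fun _ _ h => alg_mem f h

end GradedAlg

/-! ### Free extensions are generated by the base and the generators -/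

/-- The generated subalgebra is graded, so the universal property gives a map from `B` into it.
Followed by the inclusion, this map agrees with the identity on the base and on the generators,
hence is the identity by uniqueness, and the subalgebra is everything. -/
theorem IsFreeExtension.adjoin_eq_top {κ : Type} {e : κ → ℕ} {U B : GradedAlg.{u}} {i : U ⟶ B}
    {W : κ → ModuleCat.{u} ℚ} {j : ∀ k, W k ⟶ (degFunctor (e k)).obj B}
    (h : IsFreeExtension e i W j) :
    Algebra.adjoin ℚ ({b | ∃ n, ∃ a ∈ U.deg n, GradedAlg.alg i a = b} ∪
      {b | ∃ k, ∃ x : W k, (j k x).1 = b}) = ⊤ := by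
  set s : Set B.carrier := {b | ∃ n, ∃ a ∈ U.deg n, GradedAlg.alg i a = b} ∪
      {b | ∃ k, ∃ x : W k, (j k x).1 = b} with hs_def
  have hs : ∀ x ∈ s, ∃ n, x ∈ B.deg n := by
    rintro x (⟨n, a, ha, rfl⟩ | ⟨k, x, rfl⟩)
    · exact ⟨n, GradedAlg.alg_mem i ha⟩
    · exact ⟨e k, (j k x).2⟩
  have hS : ∀ n, ∀ x ∈ Algebra.adjoin ℚ s, B.proj n x ∈ Algebra.adjoin ℚ s :=
    fun n x => GradedAlg.proj_mem_adjoin hs n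
  have hi : ∀ x, GradedAlg.alg i x ∈ Algebra.adjoin ℚ s := fun x => by
    induction x using GradedAlg.homogeneous_induction with
    | hom n x hx => exact Algebra.subset_adjoin (Or.inl ⟨n, x, hx, rfl⟩)
    | add x y hx hy =>
      rw [map_add]
      exact Subalgebra.add_mem _ hx hy
  have hj : ∀ k (x : W k), (j k x).1 ∈ Algebra.adjoin ℚ s := fun k x =>
    Algebra.subset_adjoin (Or.inr ⟨k, x, rfl⟩)
  set C := GradedAlg.ofSubalgebra _ hS
  set ι : C ⟶ B := GradedAlg.ofSubalgebraIncl _ hS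
  let g : ∀ k, W k ⟶ (degFunctor (e k)).obj C := fun k =>
    ModuleCat.ofHom
      { toFun := fun x => ⟨⟨(j k x).1, hj k x⟩, (j k x).2⟩
        map_add' := fun x y => by ext; simp; rfl
        map_smul' := fun c x => by ext; simp; rfl }
  obtain ⟨r, ⟨hr1, hr2⟩, -⟩ := h C (GradedAlg.ofSubalgebraLift _ hS i hi) g
  have hid : r ≫ ι = 𝟙 B := by
    refine (h B i j).unique ⟨?_, fun k => ?_⟩ ⟨Category.comp_id i, fun k => ?_⟩
    · rw [← Category.assoc, hr1]
      rfl
    · rw [Functor.map_comp, ← Category.assoc, hr2]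
      rfl
    · rw [CategoryTheory.Functor.map_id, Category.comp_id]
  rw [eq_top_iff]
  rintro b -
  have hb : (GradedAlg.alg r b).1 = b := congrArg (fun f : B ⟶ B => GradedAlg.alg f b) hid
  rw [← hb]
  exact (GradedAlg.alg r b).2

/-! ### Morphisms of DGAs, homogeneous primitives, connectedness. -/

namespace CDGA

variable {A B C : CDGA.{u}}

/-- The algebra map underlying a morphism of DGAs. -/
abbrev alg (f : A ⟶ B) : A.carrier →ₐ[ℚ] B.carrier := (CDGA.Hom.toHom f).toAlgHom

theorem alg_mem (f : A ⟶ B) {n : ℕ} {a : A.carrier} (h : a ∈ A.deg n) : alg f a ∈ B.deg n :=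
  (CDGA.Hom.toHom f).map_deg n a h

theorem alg_d (f : A ⟶ B) (a : A.carrier) : alg f (A.d a) = B.d (alg f a) :=
  CDGA.Hom.map_d f a

theorem hom_ext {f g : A ⟶ B} (h : ∀ a, alg f a = alg g a) : f = g :=
  CDGA.Hom.ext (AlgHom.ext h)

theorem d_one : A.d 1 = 0 := by
  have h := A.leibniz 0 1 1 GradedAlg.one_mem_deg
  simpa using h

theorem proj_d (n : ℕ) (a : A.carrier) : A.proj (n + 1) (A.d a) = A.d (A.proj n a) :=
  GradedAlg.proj_linearMap A.d (· + 1) (add_left_injective 1) A.d_mem n a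

/-- A coboundary of degree `n + 1` is the differential of an element of degree `n`. -/
theorem exists_mem_deg_of_d_mem {n : ℕ} {a : A.carrier} (h : A.d a ∈ A.deg (n + 1)) :
    ∃ a' ∈ A.deg n, A.d a' = A.d a :=
  ⟨A.proj n a, GradedAlg.proj_mem n a, by rw [← proj_d, GradedAlg.proj_of_mem h]⟩

/-- A morphism of graded algebras commutes with the differentials if it does so on homogeneous
generators. -/
theorem map_d_of_adjoin_eq_top (f : A.toGradedAlg ⟶ B.toGradedAlg) {s : Set A.carrier}
    (hs : ∀ x ∈ s, ∃ n, x ∈ A.deg n) (hs' : Algebra.adjoin ℚ s = ⊤)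
    (hf : ∀ x ∈ s, GradedAlg.alg f (A.d x) = B.d (GradedAlg.alg f x)) (a : A.carrier) :
    GradedAlg.alg f (A.d a) = B.d (GradedAlg.alg f a) := by
  have ha : a ∈ Submodule.span ℚ (Submonoid.closure s : Set A.carrier) := by
    rw [← Algebra.adjoin_eq_span, hs']
    exact Submodule.mem_top
  induction ha using Submodule.span_induction with
  | mem x h =>
    induction h using Submonoid.closure_induction with
    | mem x h => exact hf x h
    | one => rw [d_one, map_zero, map_one, d_one]
    | mul x y hx _ ihx ihy =>
      obtain ⟨n, hn⟩ := GradedAlg.exists_mem_deg_of_mem_closure hs hx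
      rw [A.leibniz n x y hn, map_add, map_mul, map_smul, map_mul, ihx, ihy, map_mul,
        B.leibniz n _ _ (GradedAlg.alg_mem f hn)]
  | zero => simp
  | add x y _ _ hx hy => simp only [map_add, hx, hy]
  | smul c x _ hx => simp only [map_smul, hx]

/-- A DGA is connected if its degree zero part is spanned by the unit. -/
def IsConnected (A : CDGA.{u}) : Prop :=
  ∀ a ∈ A.deg 0, ∃ q : ℚ, algebraMap ℚ A.carrier q = a

end CDGA

/-! ### Hirsch extensions -/

namespace HirschExtension

variable {n : ℕ} {V : ModuleCat.{u} ℚ} {U B : CDGA.{u}} {i : U ⟶ B}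

/-- The inclusion of the generators, as a linear map to the underlying vector space. -/
noncomputable def genMap (E : HirschExtension n V i) : V →ₗ[ℚ] B.carrier :=
  (B.deg n).subtype ∘ₗ (E.gen.hom : V →ₗ[ℚ] B.deg n)

/-- The differential on the generators, as a linear map to the underlying vector space. -/
noncomputable def δMap (E : HirschExtension n V i) : V →ₗ[ℚ] U.carrier :=
  (U.deg (n + 1)).subtype ∘ₗ (E.δ.hom : V →ₗ[ℚ] U.deg (n + 1))

theorem genMap_mem (E : HirschExtension n V i) (x : V) : E.genMap x ∈ B.deg n := (E.gen x).2

theorem δMap_mem (E : HirschExtension n V i) (x : V) : E.δMap x ∈ U.deg (n + 1) := (E.δ x).2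

theorem d_δMap (E : HirschExtension n V i) (x : V) : U.d (E.δMap x) = 0 := E.δ_cocycle x

theorem d_genMap (E : HirschExtension n V i) (x : V) :
    B.d (E.genMap x) = CDGA.alg i (E.δMap x) := E.d_gen x

/-- The homogeneous generators of a Hirsch extension: the elements of the base and of `V`. -/
def generators (E : HirschExtension n V i) : Set B.carrier :=
  {b | (∃ m, ∃ a ∈ U.deg m, CDGA.alg i a = b) ∨ ∃ x : V, E.genMap x = b}

theorem adjoin_generators (E : HirschExtension n V i) :
    Algebra.adjoin ℚ E.generators = ⊤ := by
  refine Eq.trans (congrArg (Algebra.adjoin ℚ) ?_) E.free.adjoin_eq_top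
  ext b
  exact or_congr Iff.rfl ⟨fun h => ⟨(), h⟩, fun ⟨_, h⟩ => h⟩

theorem exists_mem_deg_of_mem_generators (E : HirschExtension n V i) :
    ∀ b ∈ E.generators, ∃ m, b ∈ B.deg m := by
  rintro b (⟨m, a, ha, rfl⟩ | ⟨x, rfl⟩)
  · exact ⟨m, CDGA.alg_mem i ha⟩
  · exact ⟨n, E.genMap_mem x⟩

/-- An element of a Hirsch extension of degree `n` of a connected DGA is the sum of an element of
the base, a generator and an element without components in degrees up to `n`. -/
theorem exists_eq_add (E : HirschExtension n V i) (hn : 0 < n) (hU : U.IsConnected)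
    (b : B.carrier) : ∃ (a : U.carrier) (x : V) (c : B.carrier),
      b = CDGA.alg i a + E.genMap x + c ∧ ∀ m ≤ n, B.proj m c = 0 := by
  have hb : b ∈ Submodule.span ℚ (Submonoid.closure E.generators : Set B.carrier) := by
    rw [← Algebra.adjoin_eq_span, E.adjoin_generators]
    exact Submodule.mem_top
  -- A monomial comes from the base, is a generator, or has degree above `n`. A generator times a
  -- base element of degree 0 stays a generator because connectedness makes that element a scalar;
  -- any other product involving a generator exceeds degree `n`.
  have key : ∀ y ∈ Submonoid.closure E.generators,
      (∃ m, ∃ a ∈ U.deg m, CDGA.alg i a = y) ∨ (∃ x : V, E.genMap x = y) ∨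
        ∃ m, n < m ∧ y ∈ B.deg m := by
    intro y hy
    induction hy using Submonoid.closure_induction with
    | mem y h => exact h.imp_right Or.inl
    | one => exact Or.inl ⟨0, 1, GradedAlg.one_mem_deg, map_one _⟩
    | mul y z hy hz ihy ihz =>
      rcases ihy with ⟨p, a, ha, rfl⟩ | ⟨x, rfl⟩ | ⟨p, hp, hyp⟩
      · rcases ihz with ⟨q, a', ha', rfl⟩ | ⟨x, rfl⟩ | ⟨q, hq, hzq⟩
        · exact Or.inl ⟨p + q, a * a', GradedAlg.mul_mem_deg ha ha', map_mul _ _ _⟩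
        · rcases Nat.eq_zero_or_pos p with rfl | hp
          · obtain ⟨c, rfl⟩ := hU a ha
            refine Or.inr (Or.inl ⟨c • x, ?_⟩)
            rw [AlgHom.commutes, ← Algebra.smul_def, map_smul]
          · exact Or.inr (Or.inr ⟨p + n, by omega,
              GradedAlg.mul_mem_deg (CDGA.alg_mem i ha) (E.genMap_mem x)⟩)
        · exact Or.inr (Or.inr ⟨p + q, by omega,
            GradedAlg.mul_mem_deg (CDGA.alg_mem i ha) hzq⟩)
      · rcases ihz with ⟨q, a, ha, rfl⟩ | ⟨x', rfl⟩ | ⟨q, hq, hzq⟩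
        · rcases Nat.eq_zero_or_pos q with rfl | hq
          · obtain ⟨c, rfl⟩ := hU a ha
            refine Or.inr (Or.inl ⟨c • x, ?_⟩)
            rw [AlgHom.commutes, ← Algebra.commutes, ← Algebra.smul_def, map_smul]
          · exact Or.inr (Or.inr ⟨n + q, by omega,
              GradedAlg.mul_mem_deg (E.genMap_mem x) (CDGA.alg_mem i ha)⟩)
        · exact Or.inr (Or.inr ⟨n + n, by omega,
            GradedAlg.mul_mem_deg (E.genMap_mem x) (E.genMap_mem x')⟩)
        · exact Or.inr (Or.inr ⟨n + q, by omega, GradedAlg.mul_mem_deg (E.genMap_mem x) hzq⟩)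
      · obtain ⟨q, hq⟩ := GradedAlg.exists_mem_deg_of_mem_closure
          E.exists_mem_deg_of_mem_generators hz
        exact Or.inr (Or.inr ⟨p + q, by omega, GradedAlg.mul_mem_deg hyp hq⟩)
  induction hb using Submodule.span_induction with
  | mem y hy =>
    rcases key y hy with ⟨m, a, -, rfl⟩ | ⟨x, rfl⟩ | ⟨m, hm, hym⟩
    · exact ⟨a, 0, 0, by simp, by simp⟩
    · exact ⟨0, x, 0, by simp, by simp⟩
    · exact ⟨0, 0, y, by simp, fun k hk => GradedAlg.proj_of_mem_ne hym (by omega)⟩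
  | zero => exact ⟨0, 0, 0, by simp, by simp⟩
  | add y z _ _ hy hz =>
    obtain ⟨a, x, c, rfl, hc⟩ := hy
    obtain ⟨a', x', c', rfl, hc'⟩ := hz
    refine ⟨a + a', x + x', c + c', ?_, fun m hm => by rw [map_add, hc m hm, hc' m hm, add_zero]⟩
    rw [map_add, map_add]
    abel
  | smul q y _ hy =>
    obtain ⟨a, x, c, rfl, hc⟩ := hy
    refine ⟨q • a, q • x, q • c, ?_, fun m hm => by rw [map_smul, hc m hm, smul_zero]⟩
    rw [map_smul, map_smul, smul_add, smul_add]

theorem exists_of_mem_deg_lt (E : HirschExtension n V i) (hU : U.IsConnected) {m : ℕ}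
    (hm : m < n) {b : B.carrier} (hb : b ∈ B.deg m) : ∃ a ∈ U.deg m, CDGA.alg i a = b := by
  obtain ⟨a, x, c, h, hc⟩ := E.exists_eq_add (by omega) hU b
  refine ⟨U.proj m a, GradedAlg.proj_mem m a, ?_⟩
  have h' := congrArg (B.proj m) h
  rw [GradedAlg.proj_of_mem hb, map_add, map_add, hc m hm.le,
    GradedAlg.proj_of_mem_ne (E.genMap_mem x) (by omega), add_zero, add_zero] at h'
  rw [h']
  exact (GradedAlg.proj_alg (CDGA.Hom.toHom i) m a).symm

theorem exists_of_mem_deg (E : HirschExtension n V i) (hn : 0 < n) (hU : U.IsConnected)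
    {b : B.carrier} (hb : b ∈ B.deg n) :
    ∃ a ∈ U.deg n, ∃ x : V, CDGA.alg i a + E.genMap x = b := by
  obtain ⟨a, x, c, h, hc⟩ := E.exists_eq_add hn hU b
  refine ⟨U.proj n a, GradedAlg.proj_mem n a, x, ?_⟩
  have h' := congrArg (B.proj n) h
  rw [GradedAlg.proj_of_mem hb, map_add, map_add, hc n le_rfl,
    GradedAlg.proj_of_mem (E.genMap_mem x), add_zero] at h'
  rw [h']
  exact congrArg (· + E.genMap x) (GradedAlg.proj_alg (CDGA.Hom.toHom i) n a).symm

theorem isConnected (E : HirschExtension n V i) (hn : 0 < n) (hU : U.IsConnected) :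
    B.IsConnected := fun b hb => by
  obtain ⟨a, ha, rfl⟩ := E.exists_of_mem_deg_lt hU hn hb
  obtain ⟨q, rfl⟩ := hU a ha
  exact ⟨q, ((CDGA.alg i).commutes q).symm⟩

/-- Morphisms of graded algebras out of a Hirsch extension. -/
theorem exists_gradedAlg_hom (E : HirschExtension n V i) {C : GradedAlg.{u}}
    (f : U.toGradedAlg ⟶ C) (l : V →ₗ[ℚ] C.deg n) :
    ∃ h : B.toGradedAlg ⟶ C, (∀ a, GradedAlg.alg h (CDGA.alg i a) = GradedAlg.alg f a) ∧
      ∀ x, GradedAlg.alg h (E.genMap x) = (l x).1 := by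
  obtain ⟨h, ⟨h1, h2⟩, -⟩ := E.free C f (fun _ => ModuleCat.ofHom l)
  refine ⟨h, fun a => ?_, fun x => ?_⟩
  · exact congrArg (fun k : U.toGradedAlg ⟶ C => GradedAlg.alg k a) h1
  · exact congrArg (fun k : V ⟶ (degFunctor n).obj C => (k x).1) (h2 ())

/-- A predicate on a Hirsch extension which defines a subalgebra holds everywhere if it holds on
the base and on the generators. -/
theorem mem_of_generators (E : HirschExtension n V i) (S : Subalgebra ℚ B.carrier)
    (h1 : ∀ a, CDGA.alg i a ∈ S) (h2 : ∀ x, E.genMap x ∈ S) (b : B.carrier) : b ∈ S := by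
  have hS : Algebra.adjoin ℚ E.generators ≤ S := by
    refine Algebra.adjoin_le ?_
    rintro b (⟨m, a, ha, rfl⟩ | ⟨x, rfl⟩)
    · exact h1 a
    · exact h2 x
  rw [E.adjoin_generators] at hS
  exact hS trivial

/-- Morphisms of DGAs out of a Hirsch extension. -/
theorem exists_hom (E : HirschExtension n V i) {C : CDGA.{u}} (f : U ⟶ C) (l : V →ₗ[ℚ] C.deg n)
    (hl : ∀ x, C.d (l x).1 = CDGA.alg f (E.δMap x)) :
    ∃ h : B ⟶ C, (∀ a, CDGA.alg h (CDGA.alg i a) = CDGA.alg f a) ∧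
      ∀ x, CDGA.alg h (E.genMap x) = (l x).1 := by
  obtain ⟨h, h1, h2⟩ := E.exists_gradedAlg_hom (CDGA.Hom.toHom f) l
  refine ⟨CDGA.Hom.mk h (CDGA.map_d_of_adjoin_eq_top h E.exists_mem_deg_of_mem_generators
    E.adjoin_generators ?_), h1, h2⟩
  rintro b (⟨m, a, ha, rfl⟩ | ⟨x, rfl⟩)
  · rw [← CDGA.alg_d, h1, h1]
    exact CDGA.alg_d f a
  · rw [E.d_genMap, h2, hl]
    exact h1 _

end HirschExtension

/-! ### The filtration of a minimal algebra -/

namespace MinimalAlgebraStructure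

variable {N : CDGA.{u}} (S : MinimalAlgebraStructure N)

theorem toN_incl (k : ℕ) (a : (S.stage k).carrier) :
    CDGA.alg (S.toN (k + 1)) (CDGA.alg (S.incl k) a) = CDGA.alg (S.toN k) a :=
  congrArg (fun f : S.stage k ⟶ N => CDGA.alg f a) (S.incl_toN k)

theorem stage_isConnected (j : ℕ) : (S.stage (j + 1)).IsConnected := by
  induction j with
  | zero => exact fun a _ => S.stage_one.2 a
  | succ j ih => exact (S.ext j).isConnected (by omega) ih

theorem exists_toN_eq_of_le {k l : ℕ} (hkl : k ≤ l) (a : (S.stage k).carrier) :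
    ∃ b, CDGA.alg (S.toN l) b = CDGA.alg (S.toN k) a := by
  induction l, hkl using Nat.le_induction with
  | base => exact ⟨a, rfl⟩
  | succ l _ ih =>
    obtain ⟨b, hb⟩ := ih
    exact ⟨CDGA.alg (S.incl l) b, by rw [S.toN_incl, hb]⟩

theorem eventually_exists_toN_eq (x : N.carrier) :
    ∃ k, ∀ l, k ≤ l → ∃ a, CDGA.alg (S.toN l) a = x := by
  obtain ⟨k, a, ha⟩ := S.union x
  refine ⟨k, fun l hl => ?_⟩
  obtain ⟨b, hb⟩ := S.exists_toN_eq_of_le hl a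
  exact ⟨b, hb.trans ha⟩

theorem mem_deg_of_toN_mem {k m : ℕ} {a : (S.stage k).carrier}
    (h : CDGA.alg (S.toN k) a ∈ N.deg m) : a ∈ (S.stage k).deg m :=
  GradedAlg.mem_deg_of_alg_mem (CDGA.Hom.toHom (S.toN k)) (S.toN_injective k) h

/-- Elements of degree at most `n` lie in the `n`-th stage, for `n ≥ 1`. -/
theorem exists_toN_eq_of_mem_deg {j m : ℕ} (hm : m ≤ j + 1) {x : N.carrier} (hx : x ∈ N.deg m) :
    ∃ a, CDGA.alg (S.toN (j + 1)) a = x := by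
  obtain ⟨k, hk⟩ := S.eventually_exists_toN_eq x
  -- Passing from stage `i + 1` to stage `i + 2` adds generators of degree `i + 2 > m` only, so
  -- nothing new appears in degree `m`.
  have descend : ∀ i, j ≤ i → (∃ a, CDGA.alg (S.toN (i + 1)) a = x) →
      ∃ a, CDGA.alg (S.toN (j + 1)) a = x := by
    intro i hji
    induction i, hji using Nat.le_induction with
    | base => exact id
    | succ i hji ih =>
      rintro ⟨a, rfl⟩
      obtain ⟨b, -, rfl⟩ := (S.ext i).exists_of_mem_deg_lt (S.stage_isConnected i) (by omega)
        (S.mem_deg_of_toN_mem hx)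
      exact ih ⟨b, (S.toN_incl _ b).symm⟩
  exact descend (j + k) (by omega) (hk _ (by omega))

/-- The differential of an element of degree `n ≥ 2` lies in the stage `n - 1`. -/
theorem exists_toN_eq_d {j : ℕ} {x : N.carrier} (hx : x ∈ N.deg (j + 2)) :
    ∃ a, CDGA.alg (S.toN (j + 1)) a = N.d x := by
  obtain ⟨b, rfl⟩ := S.exists_toN_eq_of_mem_deg (j := j + 1) le_rfl hx
  -- In degree `j + 2` the last extension contributes only linear terms `y`, and their differential
  -- is in the base.
  obtain ⟨a, -, y, rfl⟩ := (S.ext j).exists_of_mem_deg (by omega) (S.stage_isConnected j)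
    (S.mem_deg_of_toN_mem hx)
  refine ⟨(S.stage (j + 1)).d a + (S.ext j).δMap y, ?_⟩
  rw [← CDGA.alg_d, map_add (S.stage (j + 1 + 1)).d, (S.ext j).d_genMap, ← CDGA.alg_d, ← map_add]
  exact (S.toN_incl _ _).symm

/-- A compatible family of morphisms on the stages `n ≥ 1` is induced by a morphism on the
minimal algebra. -/
theorem exists_hom_of_stages {C : CDGA.{u}} (g : ∀ j, S.stage (j + 1) ⟶ C)
    (hg : ∀ j a, CDGA.alg (g (j + 1)) (CDGA.alg (S.incl (j + 1)) a) = CDGA.alg (g j) a) :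
    ∃ h : N ⟶ C, ∀ j a, CDGA.alg h (CDGA.alg (S.toN (j + 1)) a) = CDGA.alg (g j) a := by
  have up : ∀ j l, j ≤ l → ∀ a : (S.stage (j + 1)).carrier, ∃ b : (S.stage (l + 1)).carrier,
      CDGA.alg (S.toN (l + 1)) b = CDGA.alg (S.toN (j + 1)) a ∧
        CDGA.alg (g l) b = CDGA.alg (g j) a := by
    intro j l hjl a
    induction l, hjl using Nat.le_induction with
    | base => exact ⟨a, rfl, rfl⟩
    | succ l _ ih =>
      obtain ⟨b, hb, hb'⟩ := ih
      exact ⟨CDGA.alg (S.incl (l + 1)) b, by rw [S.toN_incl, hb], by rw [hg, hb']⟩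
  -- Two representatives of the same element can be moved to a common stage, where they coincide
  -- because `toN` is injective.
  have wd : ∀ j l (a : (S.stage (j + 1)).carrier) (b : (S.stage (l + 1)).carrier),
      CDGA.alg (S.toN (j + 1)) a = CDGA.alg (S.toN (l + 1)) b →
        CDGA.alg (g j) a = CDGA.alg (g l) b := by
    intro j l a b hab
    obtain ⟨a', ha, ha'⟩ := up j (max j l) (le_max_left _ _) a
    obtain ⟨b', hb, hb'⟩ := up l (max j l) (le_max_right _ _) b
    have : a' = b' := S.toN_injective _ (ha.trans (hab.trans hb.symm))
    rw [← ha', ← hb', this]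
  have ex : ∀ x : N.carrier, ∃ j, ∃ a : (S.stage (j + 1)).carrier,
      CDGA.alg (S.toN (j + 1)) a = x := fun x => by
    obtain ⟨k, hk⟩ := S.eventually_exists_toN_eq x
    exact ⟨k, hk _ (by omega)⟩
  have ex₂ : ∀ x y : N.carrier, ∃ j, ∃ a b : (S.stage (j + 1)).carrier,
      CDGA.alg (S.toN (j + 1)) a = x ∧ CDGA.alg (S.toN (j + 1)) b = y := fun x y => by
    obtain ⟨k, hk⟩ := S.eventually_exists_toN_eq x
    obtain ⟨l, hl⟩ := S.eventually_exists_toN_eq y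
    obtain ⟨a, ha⟩ := hk (max k l + 1) (by omega)
    obtain ⟨b, hb⟩ := hl (max k l + 1) (by omega)
    exact ⟨_, a, b, ha, hb⟩
  choose idx rep hrep using ex
  let h₀ : N.carrier → C.carrier := fun x => CDGA.alg (g (idx x)) (rep x)
  have h₀_toN : ∀ j a, h₀ (CDGA.alg (S.toN (j + 1)) a) = CDGA.alg (g j) a := fun j a =>
    wd _ _ _ _ (hrep _)
  let h₁ : N.carrier →ₐ[ℚ] C.carrier :=
    { toFun := h₀
      map_one' := by rw [← map_one (CDGA.alg (S.toN (0 + 1))), h₀_toN, map_one]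
      map_zero' := by rw [← map_zero (CDGA.alg (S.toN (0 + 1))), h₀_toN, map_zero]
      map_mul' := fun x y => by
        obtain ⟨j, a, b, rfl, rfl⟩ := ex₂ x y
        rw [← map_mul, h₀_toN, h₀_toN, h₀_toN, map_mul]
      map_add' := fun x y => by
        obtain ⟨j, a, b, rfl, rfl⟩ := ex₂ x y
        rw [← map_add, h₀_toN, h₀_toN, h₀_toN, map_add]
      commutes' := fun q => by
        rw [← AlgHom.commutes (CDGA.alg (S.toN (0 + 1))), h₀_toN, AlgHom.commutes] }
  refine ⟨CDGA.Hom.mk (GradedAlg.Hom.mk h₁ fun n x hx => ?_) fun x => ?_, h₀_toN⟩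
  · rw [← hrep x] at hx ⊢
    change h₀ _ ∈ _
    rw [h₀_toN]
    exact CDGA.alg_mem _ (S.mem_deg_of_toN_mem hx)
  · rw [← hrep x]
    change h₀ _ = C.d (h₀ _)
    rw [← CDGA.alg_d, h₀_toN, h₀_toN, CDGA.alg_d]

/-- The unique morphism of graded algebras from the first stage, which is `ℚ`. -/
theorem exists_stage_one_hom (C : GradedAlg.{u}) :
    ∃ g : (S.stage 1).toGradedAlg ⟶ C, ∀ q, GradedAlg.alg g (algebraMap ℚ _ q) =
      algebraMap ℚ _ q := by
  let e : ℚ ≃ₐ[ℚ] (S.stage 1).carrier :=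
    AlgEquiv.ofBijective (Algebra.ofId ℚ _) S.stage_one
  let g : (S.stage 1).carrier →ₐ[ℚ] C.carrier := (Algebra.ofId ℚ _).comp e.symm.toAlgHom
  refine ⟨GradedAlg.Hom.mk g fun n a ha => ?_, fun q => AlgHom.commutes g q⟩
  obtain ⟨q, rfl⟩ := S.stage_one.2 a
  rw [AlgHom.commutes]
  rcases Nat.eq_zero_or_pos n with rfl | hn
  · exact GradedAlg.algebraMap_mem_deg q
  -- A scalar that also lies in positive degree is zero.
  · have h0 := GradedAlg.eq_zero_of_mem_deg (GradedAlg.algebraMap_mem_deg q) ha hn.ne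
    rw [← AlgHom.commutes g, h0, map_zero]
    exact Submodule.zero_mem _

end MinimalAlgebraStructure

/-! ### Quasi-isomorphisms in terms of elements -/

namespace CDGA

variable {A B C : CDGA.{u}}

/-- The induced map in cohomology is surjective, in terms of elements. -/
def CohomologySurjective (f : A ⟶ B) : Prop :=
  ∀ n, ∀ b ∈ B.deg n, B.d b = 0 → ∃ a ∈ A.deg n, A.d a = 0 ∧ ∃ e, b = alg f a + B.d e

/-- The induced map in cohomology is injective, in terms of elements. -/
def CohomologyInjective (f : A ⟶ B) : Prop :=
  ∀ n, ∀ a ∈ A.deg n, A.d a = 0 → ∀ e, alg f a = B.d e → ∃ e', a = A.d e'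

theorem IsQuasiIso.cohomologySurjective {f : A ⟶ B} (hf : IsQuasiIso f) :
    CohomologySurjective f := by
  intro n b hb hdb
  obtain ⟨y, hy⟩ := (hf n).2 (Submodule.Quotient.mk ⟨b, hb, hdb⟩)
  obtain ⟨a, rfl⟩ := Submodule.Quotient.mk_surjective _ y
  have h : Submodule.Quotient.mk (cocyclesMap f n a) = _ := hy
  rw [eq_comm, Submodule.Quotient.eq] at h
  obtain ⟨e, he⟩ := h.2
  refine ⟨a.1, a.2.1, a.2.2, e, ?_⟩
  rw [he]
  exact (add_sub_cancel _ _).symm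

theorem IsQuasiIso.cohomologyInjective {f : A ⟶ B} (hf : IsQuasiIso f) :
    CohomologyInjective f := by
  intro n a ha hda e he
  let z : A.cocycles n := ⟨a, ha, hda⟩
  have h : cohomologyMap f n (Submodule.Quotient.mk z) = 0 := by
    change Submodule.Quotient.mk (cocyclesMap f n z) = _
    rw [Submodule.Quotient.mk_eq_zero]
    exact ⟨alg_mem f ha, e, he.symm⟩
  rw [← map_zero (cohomologyMap f n)] at h
  have h' := (hf n).1 h
  rw [Submodule.Quotient.mk_eq_zero] at h'
  obtain ⟨e', he'⟩ := h'.2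
  exact ⟨e', he'.symm⟩

theorem CohomologyInjective.of_comp {f : A ⟶ B} {g : B ⟶ C}
    (h : CohomologyInjective (f ≫ g)) : CohomologyInjective f := fun n a ha hda e he =>
  h n a ha hda (alg g e) <| by
    rw [← alg_d, ← he]
    rfl

/-- Half of two out of three: the class of `g b` comes from some `a`, and injectivity of `g` in
cohomology makes `b` and `f a` cohomologous. -/
theorem CohomologySurjective.of_comp {f : A ⟶ B} {g : B ⟶ C}
    (h : CohomologySurjective (f ≫ g)) (hg : CohomologyInjective g) :
    CohomologySurjective f := by
  intro n b hb hdb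
  obtain ⟨a, ha, hda, e, he⟩ := h n (alg g b) (alg_mem g hb) (by rw [← alg_d, hdb, map_zero])
  obtain ⟨e', he'⟩ := hg n (b - alg f a) (Submodule.sub_mem _ hb (alg_mem f ha))
    (by rw [map_sub, hdb, ← alg_d, hda, map_zero, sub_zero]) e
    (by rw [map_sub, he]; exact add_sub_cancel_left _ _)
  exact ⟨a, ha, hda, e', by rw [← he']; exact (add_sub_cancel _ _).symm⟩

end CDGA

/-- A linear map with values in the range of another one lifts along it. -/
theorem exists_linearMap_lift {K V E F : Type*} [Field K] [AddCommGroup V] [Module K V]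
    [AddCommGroup E] [Module K E] [AddCommGroup F] [Module K F] (T : E →ₗ[K] F) (s : V →ₗ[K] F)
    (h : ∀ v, ∃ e, T e = s v) : ∃ l : V →ₗ[K] E, ∀ v, T (l v) = s v := by
  obtain ⟨l, hl⟩ := Module.projective_lifting_property T.rangeRestrict
    (s.codRestrict (LinearMap.range T) h) T.surjective_rangeRestrict
  exact ⟨l, fun v => congrArg Subtype.val (LinearMap.congr_fun hl v)⟩

/-! ### Lifting along quasi-isomorphisms to DGAs with zero differential -/

section Lifting

variable {N N' C : CDGA.{u}}

/-- A generator x needs an image y with dy = g(δx) and ρ(y) = f(x). The cocycle g(δx) is exact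
because ρ sends it to d f(x) = 0 and ρ is injective in cohomology. Any primitive can be corrected by
a cocycle mapping exactly to the error f(x) - ρ(y), since in C cohomologous elements are equal. -/
theorem HirschExtension.exists_lift {n : ℕ} {V : ModuleCat.{u} ℚ} {U B : CDGA.{u}} {i : U ⟶ B}
    (E : HirschExtension n V i) (hC : C.d = 0) {ρ : N' ⟶ C} (hρ : CDGA.IsQuasiIso ρ) (f : B ⟶ C)
    (g : U ⟶ N') (hg : ∀ a, CDGA.alg ρ (CDGA.alg g a) = CDGA.alg f (CDGA.alg i a)) :
    ∃ h : B ⟶ N', (∀ a, CDGA.alg h (CDGA.alg i a) = CDGA.alg g a) ∧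
      ∀ b, CDGA.alg ρ (CDGA.alg h b) = CDGA.alg f b := by
  have hC' : ∀ c, C.d c = 0 := fun c => by rw [hC, LinearMap.zero_apply]
  -- Both conditions are solved together through the map (d, ρ), so that the choice of y is linear
  -- in x.
  obtain ⟨l, hl⟩ := exists_linearMap_lift
    ((N'.d.prod (CDGA.alg ρ).toLinearMap) ∘ₗ (N'.deg n).subtype)
    (((CDGA.alg g).toLinearMap ∘ₗ E.δMap).prod ((CDGA.alg f).toLinearMap ∘ₗ E.genMap)) fun x => by
      have hδ : N'.d (CDGA.alg g (E.δMap x)) = 0 := by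
        rw [← CDGA.alg_d, E.d_δMap, map_zero]
      obtain ⟨e, he⟩ := hρ.cohomologyInjective (n + 1) (CDGA.alg g (E.δMap x))
        (CDGA.alg_mem g (E.δMap_mem x)) hδ 0
        (by rw [hg, ← E.d_genMap, CDGA.alg_d, hC', hC'])
      -- The primitive `e` need not be homogeneous; its component of degree `n` has the same
      -- differential.
      obtain ⟨y, hy, hye⟩ := CDGA.exists_mem_deg_of_d_mem (a := e)
        (he ▸ CDGA.alg_mem g (E.δMap_mem x))
      obtain ⟨z, hz, hdz, e', he'⟩ := hρ.cohomologySurjective n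
        (CDGA.alg f (E.genMap x) - CDGA.alg ρ y)
        (Submodule.sub_mem _ (CDGA.alg_mem f (E.genMap_mem x)) (CDGA.alg_mem ρ hy)) (hC' _)
      refine ⟨⟨y + z, Submodule.add_mem _ hy hz⟩, Prod.ext ?_ ?_⟩
      · change N'.d (y + z) = CDGA.alg g (E.δMap x)
        rw [map_add, hye, hdz, add_zero, he]
      · change CDGA.alg ρ (y + z) = CDGA.alg f (E.genMap x)
        rw [hC', add_zero] at he'
        rw [map_add, ← he']
        exact add_sub_cancel _ _
  obtain ⟨h, h1, h2⟩ := E.exists_hom g l fun x => congrArg Prod.fst (hl x)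
  refine ⟨h, h1, fun b => E.mem_of_generators
    (AlgHom.equalizer ((CDGA.alg ρ).comp (CDGA.alg h)) (CDGA.alg f)) (fun a => ?_) (fun x => ?_) b⟩
  · change CDGA.alg ρ (CDGA.alg h _) = _
    rw [h1, hg]
  · change CDGA.alg ρ (CDGA.alg h _) = _
    rw [h2]
    exact congrArg Prod.snd (hl x)

/-- A morphism from a minimal algebra to a DGA with zero differential lifts along
quasi-isomorphisms. -/
theorem MinimalAlgebraStructure.exists_lift (S : MinimalAlgebraStructure N) (hC : C.d = 0) {ρ : N' ⟶ C}
    (hρ : CDGA.IsQuasiIso ρ) (f : N ⟶ C) : ∃ g : N ⟶ N', g ≫ ρ = f := by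
  -- Compatibility with `ρ` is bundled into the partial lifts, since each extension step needs it
  -- for the preceding one.
  let G : ℕ → Type u := fun j => {g : S.stage (j + 1) ⟶ N' //
    ∀ a, CDGA.alg ρ (CDGA.alg g a) = CDGA.alg f (CDGA.alg (S.toN (j + 1)) a)}
  have start : Nonempty (G 0) := by
    obtain ⟨g, hg⟩ := S.exists_stage_one_hom N'.toGradedAlg
    refine ⟨CDGA.Hom.mk g fun a => ?_, fun a => ?_⟩
    · obtain ⟨q, rfl⟩ := S.stage_one.2 a
      change GradedAlg.alg g _ = N'.d (GradedAlg.alg g _)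
      rw [hg, Algebra.algebraMap_eq_smul_one, Algebra.algebraMap_eq_smul_one, map_smul, map_smul,
        CDGA.d_one, map_zero, map_smul, CDGA.d_one]
    · obtain ⟨q, rfl⟩ := S.stage_one.2 a
      rw [AlgHom.commutes, AlgHom.commutes, AlgHom.commutes, AlgHom.commutes]
  have step : ∀ j (g : G j), ∃ g' : G (j + 1),
      ∀ a, CDGA.alg g'.1 (CDGA.alg (S.incl (j + 1)) a) = CDGA.alg g.1 a := by
    intro j g
    obtain ⟨h, h1, h2⟩ := (S.ext j).exists_lift hC hρ (S.toN (j + 2) ≫ f) g.1 fun a => by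
      rw [g.2 a, ← S.toN_incl]
      rfl
    exact ⟨⟨h, h2⟩, h1⟩
  choose next hnext using step
  let g : ∀ j, G j := fun j => Nat.rec start.some next j
  obtain ⟨h, hh⟩ := S.exists_hom_of_stages (fun j => (g j).1) fun j a => hnext j (g j) a
  refine ⟨h, CDGA.hom_ext fun x => ?_⟩
  obtain ⟨k, hk⟩ := S.eventually_exists_toN_eq x
  obtain ⟨a, rfl⟩ := hk (k + 1) (by omega)
  change CDGA.alg ρ (CDGA.alg h _) = _
  rw [hh, (g k).2]

end Lifting

/-! ### Quasi-isomorphisms of minimal algebras are isomorphisms -/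

namespace MinimalAlgebraStructure

variable {N N' : CDGA.{u}} (S : MinimalAlgebraStructure N) (S' : MinimalAlgebraStructure N')

/-- The morphism `φ` restricts to an isomorphism of the `j`-th stages, whose inverse is induced by
a morphism from the stage of `N'` to `N`. -/
def StageEquiv (φ : N ⟶ N') (j : ℕ) : Prop :=
  ∃ ψ : (S'.stage j).toGradedAlg ⟶ N.toGradedAlg,
    (∀ b, CDGA.alg φ (GradedAlg.alg ψ b) = CDGA.alg (S'.toN j) b) ∧
    (∀ a, ∃ b, GradedAlg.alg ψ b = CDGA.alg (S.toN j) a) ∧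
    ∀ b, ∃ a, GradedAlg.alg ψ b = CDGA.alg (S.toN j) a

theorem stageEquiv_one (φ : N ⟶ N') : StageEquiv S S' φ 1 := by
  obtain ⟨ψ, hψ⟩ := S'.exists_stage_one_hom N.toGradedAlg
  refine ⟨ψ, fun b => ?_, fun a => ?_, fun b => ?_⟩
  · obtain ⟨q, rfl⟩ := S'.stage_one.2 b
    rw [hψ, AlgHom.commutes, AlgHom.commutes]
  · obtain ⟨q, rfl⟩ := S.stage_one.2 a
    exact ⟨algebraMap ℚ _ q, by rw [hψ, AlgHom.commutes]⟩
  · obtain ⟨q, rfl⟩ := S'.stage_one.2 b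
    exact ⟨algebraMap ℚ _ q, by rw [hψ, AlgHom.commutes]⟩

variable {S S'} {φ : N ⟶ N'} {j : ℕ}

/-- On the common image of `ψ` and `toN`, `φ` is injective because `φ ∘ ψ` is the injective map
`S'.toN`. -/
theorem StageEquiv.eq_zero (h : StageEquiv S S' φ j) (a : (S.stage j).carrier)
    (ha : CDGA.alg φ (CDGA.alg (S.toN j) a) = 0) : CDGA.alg (S.toN j) a = 0 := by
  obtain ⟨ψ, h1, h2, -⟩ := h
  obtain ⟨b, hb⟩ := h2 a
  have hb0 : b = 0 := S'.toN_injective j <| by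
    change CDGA.alg (S'.toN j) b = CDGA.alg (S'.toN j) 0
    rw [map_zero, ← h1, hb, ha]
  rw [← hb, hb0, map_zero]

theorem StageEquiv.eq_zero_of_mem_deg (h : StageEquiv S S' φ (j + 1)) {m : ℕ} (hm : m ≤ j + 1)
    {x : N.carrier} (hx : x ∈ N.deg m) (hφ : CDGA.alg φ x = 0) : x = 0 := by
  obtain ⟨a, rfl⟩ := S.exists_toN_eq_of_mem_deg hm hx
  exact h.eq_zero a hφ

theorem StageEquiv.exists_of_mem_deg (h : StageEquiv S S' φ (j + 1)) {m : ℕ} (hm : m ≤ j + 1)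
    {y : N'.carrier} (hy : y ∈ N'.deg m) : ∃ x ∈ N.deg m, CDGA.alg φ x = y := by
  obtain ⟨b, rfl⟩ := S'.exists_toN_eq_of_mem_deg hm hy
  obtain ⟨ψ, h1, -, -⟩ := h
  exact ⟨_, GradedAlg.alg_mem ψ (S'.mem_deg_of_toN_mem hy), h1 b⟩

/-- By minimality dy lies in stage `j + 1`, so `ψ` pulls it back to N. The result is a cocycle that
becomes exact in N', hence equals dx for some x. Then y - φ(x) is a cocycle, so it is φ(c) + de with
e of degree `j + 1`, where `φ` is already surjective. -/
theorem StageEquiv.exists_of_mem_deg_succ (h : StageEquiv S S' φ (j + 1))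
    (hi : CDGA.CohomologyInjective φ) (hs : CDGA.CohomologySurjective φ) {y : N'.carrier}
    (hy : y ∈ N'.deg (j + 2)) : ∃ x ∈ N.deg (j + 2), CDGA.alg φ x = y := by
  obtain ⟨b, hb⟩ := S'.exists_toN_eq_d hy
  obtain ⟨ψ, h1, -, h3⟩ := id h
  have hz : GradedAlg.alg ψ b ∈ N.deg (j + 3) :=
    GradedAlg.alg_mem ψ (S'.mem_deg_of_toN_mem (hb ▸ N'.d_mem _ _ hy))
  -- `ψ` is not assumed to commute with d; but its values lie in stage `j + 1` of N, where `φ`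
  -- detects zero.
  have hdz : N.d (GradedAlg.alg ψ b) = 0 := by
    obtain ⟨a, ha⟩ := h3 b
    rw [ha, ← CDGA.alg_d]
    refine h.eq_zero _ ?_
    rw [CDGA.alg_d, ← ha, CDGA.alg_d, h1, hb, N'.d_d]
  obtain ⟨x', hx'⟩ := hi _ _ hz hdz y (by rw [h1, hb])
  obtain ⟨x, hx, hdx⟩ := CDGA.exists_mem_deg_of_d_mem (A := N) (hx' ▸ hz)
  obtain ⟨c, hc, -, e, he⟩ := hs (j + 2) (y - CDGA.alg φ x)
    (Submodule.sub_mem _ hy (CDGA.alg_mem φ hx))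
    (by rw [map_sub, ← CDGA.alg_d, hdx, ← hx', h1, hb, sub_self])
  have hde : N'.d e ∈ N'.deg (j + 1 + 1) := by
    rw [← sub_eq_iff_eq_add'.2 he]
    exact Submodule.sub_mem _ (Submodule.sub_mem _ hy (CDGA.alg_mem φ hx)) (CDGA.alg_mem φ hc)
  obtain ⟨e', he', hde'⟩ := CDGA.exists_mem_deg_of_d_mem hde
  obtain ⟨f, hf, rfl⟩ := h.exists_of_mem_deg le_rfl he'
  refine ⟨x + (c + N.d f), Submodule.add_mem _ hx (Submodule.add_mem _ hc (N.d_mem _ _ hf)), ?_⟩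
  rw [map_add, map_add, CDGA.alg_d, hde', ← he]
  exact add_sub_cancel _ _

/-- If φ(x) = 0, then dx = 0, since dx lies in stage `j + 1` and is killed by `φ`; hence x = de by
injectivity in cohomology. Now φ(e) is a cocycle, so φ(e) = φ(c) + d φ(g) with c a cocycle.
Injectivity in degree `j + 1` gives e = c + dg, whence x = de = 0. -/
theorem StageEquiv.eq_zero_of_mem_deg_succ (h : StageEquiv S S' φ (j + 1))
    (hi : CDGA.CohomologyInjective φ) (hs : CDGA.CohomologySurjective φ) {x : N.carrier}
    (hx : x ∈ N.deg (j + 2)) (hφ : CDGA.alg φ x = 0) : x = 0 := by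
  have hdx : N.d x = 0 := by
    obtain ⟨a, ha⟩ := S.exists_toN_eq_d hx
    rw [← ha]
    refine h.eq_zero a ?_
    rw [ha, CDGA.alg_d, hφ, map_zero]
  obtain ⟨e', rfl⟩ := hi _ x hx hdx 0 (by rw [hφ, map_zero])
  obtain ⟨e, he, hde⟩ := CDGA.exists_mem_deg_of_d_mem hx
  rw [← hde] at hφ ⊢
  obtain ⟨c, hc, hdc, f, hf⟩ := hs (j + 1) (CDGA.alg φ e) (CDGA.alg_mem φ he)
    (by rw [← CDGA.alg_d, hφ])
  have hdf : N'.d f ∈ N'.deg (j + 1) := by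
    rw [← sub_eq_iff_eq_add'.2 hf]
    exact Submodule.sub_mem _ (CDGA.alg_mem φ he) (CDGA.alg_mem φ hc)
  obtain ⟨f', hf', hdf'⟩ := CDGA.exists_mem_deg_of_d_mem hdf
  obtain ⟨g, hg, rfl⟩ := h.exists_of_mem_deg (by omega) hf'
  have h0 : e - c - N.d g = 0 := by
    refine h.eq_zero_of_mem_deg le_rfl
      (Submodule.sub_mem _ (Submodule.sub_mem _ he hc) (N.d_mem _ _ hg)) ?_
    rw [map_sub, map_sub, CDGA.alg_d, hdf', hf]
    exact sub_eq_zero.2 (add_sub_cancel_left _ _)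
  rw [sub_eq_zero.1 (show e - (c + N.d g) = 0 by rw [← sub_sub, h0]), map_add, hdc, N.d_d,
    add_zero]

/-- Since `φ` is now bijective in degree `j + 2`, `ψ` extends over the new generators of N' by
inverting `φ` on them. The images of the extended map and of stage `j + 2` of N agree because new
generators on either side have degree `j + 2`, and all elements of that degree lie in stage `j + 2`.
-/
theorem StageEquiv.succ (h : StageEquiv S S' φ (j + 1)) (hi : CDGA.CohomologyInjective φ)
    (hs : CDGA.CohomologySurjective φ) : StageEquiv S S' φ (j + 2) := by
  obtain ⟨ψ, h1, h2, h3⟩ := id h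
  let φₙ : N.deg (j + 2) →ₗ[ℚ] N'.deg (j + 2) :=
    (CDGA.alg φ).toLinearMap.restrict fun _ hx => CDGA.alg_mem φ hx
  have inj : ∀ x y : N.carrier, x ∈ N.deg (j + 2) → y ∈ N.deg (j + 2) →
      CDGA.alg φ x = CDGA.alg φ y → x = y := fun x y hx hy hxy =>
    sub_eq_zero.1 <| h.eq_zero_of_mem_deg_succ hi hs (Submodule.sub_mem _ hx hy)
      (by rw [map_sub, hxy, sub_self])
  have bij : Function.Bijective φₙ := by
    refine ⟨fun x y hxy => Subtype.ext ?_, fun y => ?_⟩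
    · exact inj _ _ x.2 y.2 (congrArg Subtype.val hxy)
    · obtain ⟨x, hx, hxy⟩ := h.exists_of_mem_deg_succ hi hs y.2
      exact ⟨⟨x, hx⟩, Subtype.ext hxy⟩
  let σ := LinearEquiv.ofBijective φₙ bij
  let l : S'.V (j + 2) →ₗ[ℚ] N.deg (j + 2) := σ.symm.toLinearMap ∘ₗ
    LinearMap.codRestrict (N'.deg (j + 2))
      ((CDGA.alg (S'.toN (j + 2))).toLinearMap ∘ₗ (S'.ext j).genMap)
      fun x => CDGA.alg_mem _ ((S'.ext j).genMap_mem x)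
  have hl : ∀ x, CDGA.alg φ (l x).1 = CDGA.alg (S'.toN (j + 2)) ((S'.ext j).genMap x) :=
    fun x => congrArg Subtype.val (σ.apply_symm_apply _)
  obtain ⟨χ, hχ1, hχ2⟩ := (S'.ext j).exists_gradedAlg_hom ψ l
  have c1 : ∀ b, CDGA.alg φ (GradedAlg.alg χ b) = CDGA.alg (S'.toN (j + 2)) b := by
    refine (S'.ext j).mem_of_generators (AlgHom.equalizer ((CDGA.alg φ).comp (GradedAlg.alg χ))
      (CDGA.alg (S'.toN (j + 2)))) (fun a => ?_) fun x => ?_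
    · change CDGA.alg φ (GradedAlg.alg χ _) = _
      rw [hχ1, h1]
      exact (S'.toN_incl _ a).symm
    · change CDGA.alg φ (GradedAlg.alg χ _) = _
      rw [hχ2, hl]
  refine ⟨χ, c1, fun a => ?_, fun b => ?_⟩
  · refine (S.ext j).mem_of_generators
      ((GradedAlg.alg χ).range.comap (CDGA.alg (S.toN (j + 2)))) (fun a => ?_) (fun x => ?_) a
    · obtain ⟨b, hb⟩ := h2 a
      refine ⟨CDGA.alg (S'.incl (j + 1)) b, ?_⟩
      exact (hχ1 b).trans (hb.trans (S.toN_incl _ a).symm)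
    · have hx := CDGA.alg_mem (S.toN (j + 2)) ((S.ext j).genMap_mem x)
      obtain ⟨b, hb⟩ := S'.exists_toN_eq_of_mem_deg (j := j + 1) le_rfl (CDGA.alg_mem φ hx)
      have hb' : b ∈ (S'.stage (j + 2)).deg (j + 2) :=
        S'.mem_deg_of_toN_mem (hb ▸ CDGA.alg_mem φ hx)
      exact ⟨b, inj _ _ (GradedAlg.alg_mem χ hb') hx ((c1 b).trans hb)⟩
  · suffices hb : b ∈ (CDGA.alg (S.toN (j + 2))).range.comap (GradedAlg.alg χ) by
      obtain ⟨a, ha⟩ := hb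
      exact ⟨a, ha.symm⟩
    refine (S'.ext j).mem_of_generators _ (fun b => ?_) (fun x => ?_) b
    · obtain ⟨a, ha⟩ := h3 b
      refine ⟨CDGA.alg (S.incl (j + 1)) a, ?_⟩
      exact (S.toN_incl _ a).trans (ha.symm.trans (hχ1 b).symm)
    · obtain ⟨a, ha⟩ := S.exists_toN_eq_of_mem_deg (j := j + 1) le_rfl (l x).2
      exact ⟨a, ha.trans (hχ2 x).symm⟩

theorem stageEquiv (S : MinimalAlgebraStructure N) (S' : MinimalAlgebraStructure N')
    (hi : CDGA.CohomologyInjective φ) (hs : CDGA.CohomologySurjective φ) (j : ℕ) :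
    StageEquiv S S' φ (j + 1) := by
  induction j with
  | zero => exact stageEquiv_one S S' φ
  | succ j ih => exact ih.succ hi hs

/-- A morphism of minimal algebras which induces an isomorphism in cohomology is bijective. -/
theorem bijective_of_cohomology (S : MinimalAlgebraStructure N) (S' : MinimalAlgebraStructure N')
    (hi : CDGA.CohomologyInjective φ) (hs : CDGA.CohomologySurjective φ) :
    Function.Bijective (CDGA.alg φ) := by
  refine ⟨(injective_iff_map_eq_zero _).2 fun x hx => ?_, fun y => ?_⟩
  · obtain ⟨k, hk⟩ := S.eventually_exists_toN_eq x
    obtain ⟨a, rfl⟩ := hk (k + 1) (by omega)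
    exact (stageEquiv S S' hi hs k).eq_zero a hx
  · obtain ⟨k, hk⟩ := S'.eventually_exists_toN_eq y
    obtain ⟨b, rfl⟩ := hk (k + 1) (by omega)
    obtain ⟨ψ, h1, -, -⟩ := stageEquiv S S' hi hs k
    exact ⟨_, h1 b⟩

end MinimalAlgebraStructure

/-- A bijective morphism of DGAs is an isomorphism. -/
theorem CDGA.nonempty_iso_of_bijective {A B : CDGA.{u}} (f : A ⟶ B)
    (hf : Function.Bijective (CDGA.alg f)) : Nonempty (A ≅ B) := by
  let e := AlgEquiv.ofBijective (CDGA.alg f) hf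
  have he : ∀ b, CDGA.alg f (e.symm b) = b := e.apply_symm_apply
  let g : B ⟶ A := CDGA.Hom.mk
    (GradedAlg.Hom.mk (A := B.toGradedAlg) (B := A.toGradedAlg) e.symm.toAlgHom fun n b hb =>
      GradedAlg.mem_deg_of_alg_mem (CDGA.Hom.toHom f) hf.1 (by
        change CDGA.alg f (e.symm b) ∈ _
        rwa [he]))
    fun b => hf.1 (by
      change CDGA.alg f (e.symm (B.d b)) = CDGA.alg f (A.d (e.symm b))
      rw [he, CDGA.alg_d, he])
  exact ⟨⟨f, g, CDGA.hom_ext fun a => e.symm_apply_apply a, CDGA.hom_ext fun b => he b⟩⟩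

/-- Minimal models of a DGA with zero differential are unique up to isomorphism. -/
theorem MinimalAlgebraStructure.nonempty_iso {N N' C : CDGA.{u}} (S : MinimalAlgebraStructure N)
    (S' : MinimalAlgebraStructure N') (hC : C.d = 0) {ρ : N ⟶ C} (hρ : CDGA.IsQuasiIso ρ)
    {ρ' : N' ⟶ C} (hρ' : CDGA.IsQuasiIso ρ') : Nonempty (N ≅ N') := by
  obtain ⟨g, rfl⟩ := S.exists_lift hC hρ' ρ
  exact CDGA.nonempty_iso_of_bijective g (S.bijective_of_cohomology S'
    hρ.cohomologyInjective.of_comp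
    (hρ.cohomologySurjective.of_comp hρ'.cohomologyInjective))

/-! ### Minimal systems with injective associated systems of vector spaces -/

section Injective

open Limits

variable {C : Type*} [Category C]

/-- Injectivity of `X` splits `f`; essentiality makes the retraction mono, and a mono with a section
is an isomorphism. -/
theorem IsInjectiveEnvelope.isIso {X Y : C} {f : X ⟶ Y} (hf : IsInjectiveEnvelope f)
    [Injective X] : IsIso f := by
  have := hf.mono
  have hr : f ≫ Injective.factorThru (𝟙 X) f = 𝟙 X := Injective.comp_factorThru _ _
  have : Mono (Injective.factorThru (𝟙 X) f) := hf.essential _ (by rw [hr]; infer_instance)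
  refine ⟨Injective.factorThru (𝟙 X) f, hr, ?_⟩
  rw [← cancel_mono (Injective.factorThru (𝟙 X) f), Category.assoc, hr, Category.comp_id,
    Category.id_comp]

/-- Every map out of the zero object `X` is mono, so essentiality makes even the zero map out of `Y`
mono. -/
theorem IsInjectiveEnvelope.isZero [HasZeroMorphisms C] [HasZeroObject C] {X Y : C} {f : X ⟶ Y}
    (hf : IsInjectiveEnvelope f) (hX : IsZero X) : IsZero Y := by
  obtain ⟨Z, hZ⟩ := HasZeroObject.zero (C := C)
  have : Mono (0 : Y ⟶ Z) := hf.essential _ ⟨fun a b _ => hX.eq_of_tgt a b⟩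
  exact IsZero.of_mono (0 : Y ⟶ Z) hZ

variable {G : Type v} [Group G] {V : DualCoeff.{v, u} G}

/-- The minimal injective resolution of an injective system is concentrated in degree zero. -/
theorem MinimalInjectiveResolution.isZero_I_succ (R : MinimalInjectiveResolution V) [Injective V]
    (k : ℕ) : IsZero (R.I (k + 1)) := by
  induction k with
  | zero =>
    have := R.env_zero.isIso
    exact R.env_one.isZero (isZero_cokernel_of_epi _)
  | succ k ih =>
    -- The target of `w k` is zero by induction, so its cokernel vanishes, and with it the envelope
    -- of that cokernel.
    have : Epi (R.w k) := ⟨fun a b _ => ih.eq_of_src a b⟩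
    exact (R.env_succ k).isZero (isZero_cokernel_of_epi _)

end Injective

/-! ### Evaluating a minimal system at an orbit. -/

section Evaluation

variable {G : Type v} [Group G]

/-- Only the generators with k = 0 survive, where the sign is 1 and the `w` term vanishes. The
cocycle condition follows from d α₀ = α₁ w₀ = 0. Using `I 0` itself as the generating space avoids
transport along the isomorphism with `V`. -/
theorem ElementaryExtension.hirsch {n : ℕ} {V : DualCoeff.{v, u} G} {U B : DiagramDGA.{v, u} G}
    {i : U ⟶ B} (E : ElementaryExtension n V i) [Injective V] (X : OrbitCat G) :
    Nonempty (HirschExtension n ((E.res.I 0).obj X) (i.app X)) := by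
  have := E.res.env_zero.isIso
  have hz : ∀ k, Limits.IsZero ((E.res.I (k + 1)).obj X) := fun k =>
    (E.res.isZero_I_succ k).obj X
  have hzero : ∀ k (x : (E.res.I (k + 1)).obj X), x = 0 := fun k x => by
    have := ModuleCat.subsingleton_of_isZero (hz k)
    exact Subsingleton.elim _ _
  refine ⟨
    { δ := (E.αk 0).app X
      δ_cocycle := fun x => ?_
      gen := (E.gen 0).app X
      d_gen := fun x => ?_
      free := fun C f g => ?_ }⟩
  · refine (E.w_αk 0 X x).symm.trans ?_
    rw [hzero 0 ((E.res.w 0).app X x), map_zero]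
    rfl
  · refine (E.d_gen 0 X x).trans ?_
    rw [hzero 0 ((E.res.w 0).app X x), map_zero, pow_zero, one_smul]
    exact add_zero _
  · let g' : ∀ k, (E.res.I k).obj X ⟶ (degFunctor (n + k)).obj C := fun k =>
      match k with
      | 0 => g ()
      | k + 1 => 0
    obtain ⟨h, ⟨h1, h2⟩, h3⟩ := E.free X C f g'
    refine ⟨h, ⟨h1, fun _ => h2 0⟩, fun h' hh => h3 h' ⟨hh.1, fun k => ?_⟩⟩
    match k with
    | 0 => exact hh.2 ()
    | k + 1 => exact (hz k).eq_of_src _ _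

theorem MinimalSystemStructure.isMinimal {M : DiagramDGA.{v, u} G} (S : MinimalSystemStructure M)
    (hV : ∀ n, 2 ≤ n → Injective (S.V n)) (X : OrbitCat G) : (M.obj X).IsMinimal := by
  have ext : ∀ n, Nonempty (HirschExtension (n + 2) (((S.ext n).res.I 0).obj X)
      ((S.incl (n + 1)).app X)) := fun n =>
    have := hV (n + 2) (by omega)
    (S.ext n).hirsch X
  exact ⟨
    { stage := fun n => (S.stage n).obj X
      incl := fun n => (S.incl n).app X
      toN := fun n => (S.toM n).app X
      incl_toN := fun n => by rw [← NatTrans.comp_app, S.incl_toM]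
      toN_injective := fun n => S.toM_injective n X
      union := S.union X
      stage_zero := S.stage_zero X
      stage_one := S.stage_one X
      -- The generators are indexed by their degree while `S.ext` starts at degree 2; the values at
      -- 0 and 1 are never used.
      V := fun n => ((S.ext (n - 2)).res.I 0).obj X
      ext := fun n => (ext n).some }⟩

end Evaluation

end EquivariantDGA

theorem mainTheorem11 {G : Type v} [Group G] [Finite G]
    (A : EquivariantDGA.DiagramGA.{v, u} G) (hA : A.IsSystem)
    (M : EquivariantDGA.DiagramDGA.{v, u} G)
    (S : EquivariantDGA.MinimalSystemStructure M)
    (ρ : M ⟶ A ⋙ EquivariantDGA.zeroD)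
    (hρ : EquivariantDGA.DiagramDGA.IsQuasiIso ρ)
    (hV : ∀ n, 2 ≤ n → CategoryTheory.Injective (S.V n))
    (H : Subgroup G)
    (N : EquivariantDGA.CDGA.{u}) (hN : N.IsMinimal)
    (ρH : N ⟶ EquivariantDGA.zeroD.obj (A.obj ⟨H⟩))
    (hρH : EquivariantDGA.CDGA.IsQuasiIso ρH) :
    Nonempty (M.obj ⟨H⟩ ≅ N) := by
  obtain ⟨T⟩ := S.isMinimal hV ⟨H⟩
  obtain ⟨T'⟩ := hN
  -- Here `rfl` is the vanishing of the differential of `zeroD`.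
  exact T.nonempty_iso T' rfl (hρ ⟨H⟩) hρH
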